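/- For a matroid $M$ on a finite ground set $E$, an automorphism of $M$ is a bijection $\phi : E \to E$ such that, for every $C \subseteq E$, $\phi(C)$ is a circuit of $M$ if and only if $C$ is a circuit of $M$. A set $S \subseteq E$ is a fixing set of $M$ if the identity is the only automorphism of $M$ that fixes every element of $S$, and the fixing number $\mathrm{fix}(M)$ is the minimum size of a fixing set of $M$. For a finite graph $G$, the cycle matroid $M(G)$ is the matroid on the edge set of $G$ whose circuits are the edge sets of the cycles of $G$. The bicircular matroid $B(G)$ is the matroid on the edge set of $G$ whose circuits are the edge sets of the bicycles of $G$, that is, of the subgraphs of $G$ that are subdivisions of one of the following graphs: two loops incident to the same vertex, two loops joined by an edge, or three edges joining the same pair of vertices. Let $K_{n,n}$ be the complete bipartite graph with $n$ vertices in each part. Theorem. 1. $\mathrm{fix}(M(K_{n,n})) = n$ for every integer $n > 2$, and $\mathrm{fix}(M(K_{2,2})) = 3$. 2. $\mathrm{fix}(B(K_{n,n})) = n$ for every integer $n > 2$, and $\mathrm{fix}(B(K_{2,2})) = 3$. -/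

import Mathlib

namespace SimpleGraph

/-- The set of end vertices of the edges in `C`. -/
def edgeEnds {V : Type*} (C : Set (Sym2 V)) : Set V := {v | ∃ e ∈ C, v ∈ e}

theorem edgeEnds_mono {V : Type*} {C D : Set (Sym2 V)} (h : C ⊆ D) : edgeEnds C ⊆ edgeEnds D :=
  fun _ ⟨e, he, hv⟩ => ⟨e, h he, hv⟩

theorem edgeEnds_union {V : Type*} (C D : Set (Sym2 V)) :
    edgeEnds (C ∪ D) = edgeEnds C ∪ edgeEnds D := by
  ext v; simp only [edgeEnds, Set.mem_union, Set.mem_ofPred_eq]; grind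

/-! ### The cycle matroid -/

/-- `C` is the edge set of a cycle of `G`. -/
def IsCycleEdgeSet {V : Type*} (G : SimpleGraph V) (C : Set (Sym2 V)) : Prop :=
  ∃ (u : V) (c : G.Walk u u), c.IsCycle ∧ C = c.edgeSet

theorem cycleFree_iff_isAcyclic {V : Type*} {G : SimpleGraph V} {I : Set (Sym2 V)}
    (hI : I ⊆ G.edgeSet) :
    (∀ C ⊆ I, ¬ G.IsCycleEdgeSet C) ↔ (fromEdgeSet I).IsAcyclic := by
  constructor
  · intro h u c hc
    have hle : fromEdgeSet I ≤ G := by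
      intro a b hab
      exact hI ((fromEdgeSet_adj I).1 hab).1
    refine h c.edgeSet ?_ ⟨u, c.mapLe hle, hc.mapLe hle, ?_⟩
    · intro e he
      have := c.edges_subset_edgeSet he
      rw [edgeSet_fromEdgeSet] at this
      exact this.1
    · simp
  · rintro h C hC ⟨u, c, hc, rfl⟩
    have hmem : ∀ e ∈ c.edges, e ∈ (fromEdgeSet I).edgeSet := by
      intro e he
      rw [edgeSet_fromEdgeSet]
      exact ⟨hC he, G.not_isDiag_of_mem_edgeSet (c.edges_subset_edgeSet he)⟩
    exact h (c.transfer _ hmem) (hc.transfer hmem)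

theorem fromEdgeSet_insert {V : Type*} (I : Set (Sym2 V)) (u v : V) :
    fromEdgeSet (insert s(u, v) I) = fromEdgeSet I ⊔ edge u v := by
  rw [edge, Set.insert_eq, Set.union_comm, fromEdgeSet_union]

theorem reachable_sup_edge {V : Type*} {G : SimpleGraph V} {u v a b : V}
    (h : (G ⊔ edge u v).Reachable a b) :
    G.Reachable a b ∨ (G.Reachable a u ∧ G.Reachable v b) ∨
      (G.Reachable a v ∧ G.Reachable u b) := by
  obtain ⟨p⟩ := h
  induction p with
  | nil => exact Or.inl (Reachable.refl _)
  | @cons a c b hac p ih =>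
    rw [sup_adj, edge_adj] at hac
    rcases hac with hac | ⟨⟨rfl, rfl⟩ | ⟨rfl, rfl⟩, _⟩
    · have := hac.reachable
      rcases ih with h | ⟨h, h'⟩ | ⟨h, h'⟩
      · exact Or.inl (this.trans h)
      · exact Or.inr (Or.inl ⟨this.trans h, h'⟩)
      · exact Or.inr (Or.inr ⟨this.trans h, h'⟩)
    · rcases ih with h | ⟨h, h'⟩ | ⟨h, h'⟩
      · exact Or.inr (Or.inl ⟨Reachable.refl _, h⟩)
      · exact Or.inr (Or.inl ⟨Reachable.refl _, h'⟩)
      · exact Or.inl h'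
    · rcases ih with h | ⟨h, h'⟩ | ⟨h, h'⟩
      · exact Or.inr (Or.inr ⟨Reachable.refl _, h⟩)
      · exact Or.inl h'
      · exact Or.inr (Or.inr ⟨Reachable.refl _, h'⟩)

theorem card_components_sup_edge {V : Type*} [Finite V] {G : SimpleGraph V} {u v : V}
    (h : ¬ G.Reachable u v) :
    Nat.card G.ConnectedComponent = Nat.card (G ⊔ edge u v).ConnectedComponent + 1 := by
  classical
  have hle : G ≤ G ⊔ edge u v := le_sup_left
  let f := ConnectedComponent.map (Hom.ofLE hle)
  have hsurj : Function.Surjective f := ConnectedComponent.surjective_map_ofLE hle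
  have hne : u ≠ v := by rintro rfl; exact h (Reachable.refl _)
  have huv : f (G.connectedComponentMk u) = f (G.connectedComponentMk v) := by
    change (G ⊔ edge u v).connectedComponentMk u = (G ⊔ edge u v).connectedComponentMk v
    rw [ConnectedComponent.eq]
    apply Adj.reachable
    rw [sup_adj, edge_adj]
    exact Or.inr ⟨Or.inl ⟨rfl, rfl⟩, hne⟩
  have hinj : Set.InjOn f {G.connectedComponentMk u}ᶜ := by
    intro x hx y hy hxy
    induction x using ConnectedComponent.ind with | _ a
    induction y using ConnectedComponent.ind with | _ b
    change (G ⊔ edge u v).connectedComponentMk a = (G ⊔ edge u v).connectedComponentMk b at hxy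
    rw [ConnectedComponent.eq] at hxy
    simp only [Set.mem_compl_iff, Set.mem_singleton_iff, ConnectedComponent.eq] at hx hy
    rw [ConnectedComponent.eq]
    rcases reachable_sup_edge hxy with h | ⟨h, h'⟩ | ⟨h, h'⟩
    · exact h
    · exact absurd h hx
    · exact absurd h'.symm hy
  have himg : f '' {G.connectedComponentMk u}ᶜ = Set.univ := by
    apply Set.eq_univ_of_forall
    intro y
    obtain ⟨x, rfl⟩ := hsurj y
    by_cases hx : x = G.connectedComponentMk u
    · refine ⟨G.connectedComponentMk v, ?_, by rw [hx, huv]⟩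
      simp only [Set.mem_compl_iff, Set.mem_singleton_iff, ConnectedComponent.eq]
      exact fun h' => h h'.symm
    · exact ⟨x, hx, rfl⟩
  have h1 := hinj.ncard_image
  rw [himg, Set.ncard_univ] at h1
  have h2 := Set.ncard_add_ncard_compl ({G.connectedComponentMk u} : Set G.ConnectedComponent)
  rw [Set.ncard_singleton] at h2
  omega

theorem card_forest {V : Type*} [Finite V] (I : Set (Sym2 V))
    (hd : ∀ e ∈ I, ¬ e.IsDiag) (hI : (fromEdgeSet I).IsAcyclic) :
    I.ncard + Nat.card (fromEdgeSet I).ConnectedComponent = Nat.card V := by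
  induction I, I.toFinite using Set.Finite.induction_on with
  | empty =>
    simp only [Set.ncard_empty, zero_add]
    rw [fromEdgeSet_empty]
    refine (Nat.card_eq_of_bijective (⊥ : SimpleGraph V).connectedComponentMk ⟨?_, ?_⟩).symm
    · intro a b hab
      rw [ConnectedComponent.eq, reachable_bot] at hab
      exact hab
    · intro x
      induction x using ConnectedComponent.ind with | _ a
      exact ⟨a, rfl⟩
  | @insert e I heI hfin ih =>
    induction e using Sym2.ind with | _ u v
    rw [fromEdgeSet_insert, isAcyclic_sup_fromEdgeSet_iff] at hI
    have hne : u ≠ v := fun h => hd s(u, v) (Set.mem_insert _ _) (by simpa using h)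
    have hnr : ¬ (fromEdgeSet I).Reachable u v := by
      intro hr
      rcases hI.2 hr with h | h
      · exact hne h
      · exact heI ((fromEdgeSet_adj I).1 h).1
    have := ih (fun e he => hd e (Set.mem_insert_of_mem _ he)) hI.1
    rw [fromEdgeSet_insert, Set.ncard_insert_of_notMem heI]
    have := card_components_sup_edge hnr
    omega

theorem exists_insert_isAcyclic {V : Type*} [Finite V] {I J : Set (Sym2 V)}
    (hdI : ∀ e ∈ I, ¬ e.IsDiag) (hdJ : ∀ e ∈ J, ¬ e.IsDiag)
    (hI : (fromEdgeSet I).IsAcyclic) (hJ : (fromEdgeSet J).IsAcyclic) (hlt : I.ncard < J.ncard) :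
    ∃ e ∈ J, e ∉ I ∧ (fromEdgeSet (insert e I)).IsAcyclic := by
  by_contra! hcon
  have hadj : ∀ a b, (fromEdgeSet J).Adj a b → (fromEdgeSet I).Reachable a b := by
    intro a b hab
    by_cases hmem : s(a, b) ∈ I
    · apply Adj.reachable
      rw [fromEdgeSet_adj]
      exact ⟨hmem, hab.ne⟩
    · have := hcon s(a, b) ((fromEdgeSet_adj J).1 hab).1 hmem
      rw [fromEdgeSet_insert, isAcyclic_sup_fromEdgeSet_iff] at this
      by_contra hr
      exact this ⟨hI, fun h => absurd h hr⟩
  have hreach : ∀ a b, (fromEdgeSet J).Reachable a b → (fromEdgeSet I).Reachable a b := by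
    rintro a b ⟨p⟩
    induction p with
    | nil => exact Reachable.refl _
    | cons h p ih => exact (hadj _ _ h).trans ih
  have hle : Nat.card (fromEdgeSet I).ConnectedComponent ≤
      Nat.card (fromEdgeSet J).ConnectedComponent := by
    refine Nat.card_le_card_of_surjective
      (Quot.map id hreach : (fromEdgeSet J).ConnectedComponent →
        (fromEdgeSet I).ConnectedComponent) ?_
    intro x
    induction x using ConnectedComponent.ind with | _ a
    exact ⟨(fromEdgeSet J).connectedComponentMk a, rfl⟩
  have h1 := card_forest I hdI hI
  have h2 := card_forest J hdJ hJ
  omega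

/-- The cycle matroid `M(G)` of a finite simple graph: its ground set is the edge set of `G`, and
a set of edges is dependent when it contains a cycle of `G`. -/
def cycleMatroid {V : Type*} [Finite V] (G : SimpleGraph V) : Matroid (Sym2 V) :=
  (IndepMatroid.ofFinite (E := G.edgeSet) (Set.toFinite _)
    (fun I => I ⊆ G.edgeSet ∧ ∀ C ⊆ I, ¬ G.IsCycleEdgeSet C)
    ⟨Set.empty_subset _, by
      rintro C hC ⟨u, c, hc, rfl⟩
      rw [Set.subset_empty_iff] at hC
      obtain ⟨e, he⟩ := List.exists_mem_of_ne_nil c.edges (by simpa using hc.not_nil)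
      exact Set.notMem_empty e (hC ▸ he)⟩
    (fun _ _ hJ hIJ => ⟨hIJ.trans hJ.1, fun C hC => hJ.2 C (hC.trans hIJ)⟩)
    (by
      rintro I J ⟨hI, hI'⟩ ⟨hJ, hJ'⟩ hlt
      rw [cycleFree_iff_isAcyclic hI] at hI'
      rw [cycleFree_iff_isAcyclic hJ] at hJ'
      obtain ⟨e, heJ, heI, h⟩ := exists_insert_isAcyclic
        (fun e he => G.not_isDiag_of_mem_edgeSet (hI he))
        (fun e he => G.not_isDiag_of_mem_edgeSet (hJ he)) hI' hJ' hlt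
      have hs : insert e I ⊆ G.edgeSet := Set.insert_subset (hJ heJ) hI
      exact ⟨e, heJ, heI, hs, (cycleFree_iff_isAcyclic hs).2 h⟩)
    (fun _ h => h.1)).matroid

/-! ### The bicircular matroid -/

/-- A theta graph in `G` (a subdivision of three edges joining the same pair of vertices): `C` is
the union of three edge-disjoint paths joining two distinct vertices `u`, `v`, no two of which
share a vertex other than `u` and `v`. -/
def IsThetaEdgeSet {V : Type*} (G : SimpleGraph V) (C : Set (Sym2 V)) : Prop :=
  ∃ (u v : V) (p q r : G.Walk u v), u ≠ v ∧ p.IsPath ∧ q.IsPath ∧ r.IsPath ∧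
    Disjoint p.edgeSet q.edgeSet ∧ Disjoint p.edgeSet r.edgeSet ∧ Disjoint q.edgeSet r.edgeSet ∧
    (∀ x ∈ p.support, x ∈ q.support → x = u ∨ x = v) ∧
    (∀ x ∈ p.support, x ∈ r.support → x = u ∨ x = v) ∧
    (∀ x ∈ q.support, x ∈ r.support → x = u ∨ x = v) ∧
    C = p.edgeSet ∪ q.edgeSet ∪ r.edgeSet

/-- A tight handcuff in `G` (a subdivision of two loops at the same vertex): `C` is the union of
two cycles that share exactly one vertex. -/
def IsTightHandcuffEdgeSet {V : Type*} (G : SimpleGraph V) (C : Set (Sym2 V)) : Prop :=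
  ∃ (u : V) (c d : G.Walk u u), c.IsCycle ∧ d.IsCycle ∧
    (∀ x ∈ c.support, x ∈ d.support → x = u) ∧
    C = c.edgeSet ∪ d.edgeSet

/-- A loose handcuff in `G` (a subdivision of two loops joined by an edge): `C` is the union of two
vertex-disjoint cycles and of a path that meets each of them exactly in one of its ends. -/
def IsLooseHandcuffEdgeSet {V : Type*} (G : SimpleGraph V) (C : Set (Sym2 V)) : Prop :=
  ∃ (u v : V) (c : G.Walk u u) (d : G.Walk v v) (p : G.Walk u v),
    c.IsCycle ∧ d.IsCycle ∧ p.IsPath ∧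
    (∀ x ∈ c.support, x ∉ d.support) ∧
    (∀ x ∈ c.support, x ∈ p.support → x = u) ∧
    (∀ x ∈ d.support, x ∈ p.support → x = v) ∧
    C = c.edgeSet ∪ d.edgeSet ∪ p.edgeSet

/-- `C` is the edge set of a bicycle of `G`. -/
def IsBicycleEdgeSet {V : Type*} (G : SimpleGraph V) (C : Set (Sym2 V)) : Prop :=
  G.IsThetaEdgeSet C ∨ G.IsTightHandcuffEdgeSet C ∨ G.IsLooseHandcuffEdgeSet C

theorem ncard_list_le {α : Type*} (l : List α) : {x | x ∈ l}.ncard ≤ l.length := by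
  classical
  have : {x | x ∈ l} = (l.toFinset : Set α) := by ext; simp
  rw [this, Set.ncard_coe_finset]
  exact l.toFinset_card_le

theorem ncard_edgeSet_walk {V : Type*} {G : SimpleGraph V} {u v : V} {p : G.Walk u v}
    (hp : p.IsTrail) : p.edgeSet.ncard = p.length := by
  classical
  rw [← Walk.coe_edges_toFinset, Set.ncard_coe_finset, List.toFinset_card_of_nodup hp.edges_nodup,
    Walk.length_edges]

theorem mem_support_of_mem_edgeEnds {V : Type*} {G : SimpleGraph V} {u v x : V} {p : G.Walk u v}
    (hx : x ∈ edgeEnds p.edgeSet) : x ∈ p.support := by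
  obtain ⟨e, he, hxe⟩ := hx
  exact Walk.mem_support_of_mem_edges (Walk.mem_edgeSet.1 he) hxe

theorem mem_interior {V : Type*} {G : SimpleGraph V} {u v x : V} {p : G.Walk u v}
    (hx : x ∈ p.support) : x = u ∨ x = v ∨ x ∈ p.support.tail.dropLast := by
  cases p with
  | nil => simp at hx; exact Or.inl hx
  | cons h p =>
    rw [Walk.support_cons, List.mem_cons] at hx
    rcases hx with hx | hx
    · exact Or.inl hx
    · right
      have := List.dropLast_append_getLast p.support_ne_nil
      rw [Walk.getLast_support] at this
      rw [← this] at hx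
      rw [List.mem_append, List.mem_singleton] at hx
      exact hx.symm

theorem edgeEnds_lt_theta {V : Type*} [Finite V] {G : SimpleGraph V} {C : Set (Sym2 V)}
    (h : G.IsThetaEdgeSet C) : (edgeEnds C).ncard < C.ncard := by
  obtain ⟨u, v, p, q, r, huv, hp, hq, hr, hpq, hpr, hqr, -, -, -, rfl⟩ := h
  have hlp := Walk.not_nil_iff_lt_length.1 (Walk.not_nil_of_ne (p := p) huv)
  have hlq := Walk.not_nil_iff_lt_length.1 (Walk.not_nil_of_ne (p := q) huv)
  have hlr := Walk.not_nil_iff_lt_length.1 (Walk.not_nil_of_ne (p := r) huv)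
  rw [Set.ncard_union_eq (Set.disjoint_union_left.2 ⟨hpr, hqr⟩), Set.ncard_union_eq hpq,
    ncard_edgeSet_walk hp.isTrail, ncard_edgeSet_walk hq.isTrail, ncard_edgeSet_walk hr.isTrail]
  have hsub : edgeEnds (p.edgeSet ∪ q.edgeSet ∪ r.edgeSet) ⊆
      {x | x ∈ p.support ++ (q.support.tail.dropLast ++ r.support.tail.dropLast)} := by
    rw [edgeEnds_union, edgeEnds_union]
    rintro x ((hx | hx) | hx)
    · have := mem_support_of_mem_edgeEnds hx
      simp [this]
    · rcases mem_interior (mem_support_of_mem_edgeEnds hx) with rfl | rfl | h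
      · simp
      · simp
      · simp [h]
    · rcases mem_interior (mem_support_of_mem_edgeEnds hx) with rfl | rfl | h
      · simp
      · simp
      · simp [h]
  have h1 := (Set.ncard_le_ncard hsub (Set.toFinite _)).trans (ncard_list_le _)
  simp only [List.length_append, List.length_dropLast, List.length_tail, Walk.length_support] at h1
  omega

theorem edgeEnds_lt_tight {V : Type*} [Finite V] {G : SimpleGraph V} {C : Set (Sym2 V)}
    (h : G.IsTightHandcuffEdgeSet C) : (edgeEnds C).ncard < C.ncard := by
  obtain ⟨u, c, d, hc, hd, hcd, rfl⟩ := h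
  have hdisj : Disjoint c.edgeSet d.edgeSet := by
    rw [Set.disjoint_left]
    intro e hec hed
    induction e using Sym2.ind with | _ a b
    have ha := hcd a (Walk.fst_mem_support_of_mem_edges _ hec)
      (Walk.fst_mem_support_of_mem_edges _ hed)
    have hb := hcd b (Walk.snd_mem_support_of_mem_edges _ hec)
      (Walk.snd_mem_support_of_mem_edges _ hed)
    exact (c.adj_of_mem_edges hec).ne (ha.trans hb.symm)
  have h3 := hc.three_le_length
  have h3' := hd.three_le_length
  rw [Set.ncard_union_eq hdisj, ncard_edgeSet_walk hc.isTrail, ncard_edgeSet_walk hd.isTrail]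
  have hu : u ∈ c.support.tail := Walk.end_mem_tail_support hc.not_nil
  have hsub : edgeEnds (c.edgeSet ∪ d.edgeSet) ⊆
      {x | x ∈ c.support.tail ++ d.support.tail.dropLast} := by
    rw [edgeEnds_union]
    rintro x (hx | hx)
    · have := mem_support_of_mem_edgeEnds hx
      rw [Walk.mem_support_iff] at this
      rcases this with rfl | h
      · simp [hu]
      · simp [h]
    · rcases mem_interior (mem_support_of_mem_edgeEnds hx) with rfl | rfl | h
      · simp [hu]
      · simp [hu]
      · simp [h]
  have h1 := (Set.ncard_le_ncard hsub (Set.toFinite _)).trans (ncard_list_le _)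
  simp only [List.length_append, List.length_dropLast, List.length_tail, Walk.length_support] at h1
  omega

theorem edgeEnds_lt_loose {V : Type*} [Finite V] {G : SimpleGraph V} {C : Set (Sym2 V)}
    (h : G.IsLooseHandcuffEdgeSet C) : (edgeEnds C).ncard < C.ncard := by
  obtain ⟨u, v, c, d, p, hc, hd, hp, hcd, hcp, hdp, rfl⟩ := h
  have huv : u ≠ v := by
    rintro rfl
    exact hcd u c.start_mem_support d.start_mem_support
  have hdisj : Disjoint c.edgeSet d.edgeSet := by
    rw [Set.disjoint_left]
    intro e hec hed
    induction e using Sym2.ind with | _ a b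
    exact hcd a (Walk.fst_mem_support_of_mem_edges _ hec)
      (Walk.fst_mem_support_of_mem_edges _ hed)
  have hdisj' : Disjoint (c.edgeSet ∪ d.edgeSet) p.edgeSet := by
    rw [Set.disjoint_left]
    intro e he hep
    induction e using Sym2.ind with | _ a b
    have hne := (p.adj_of_mem_edges hep).ne
    have ha := Walk.fst_mem_support_of_mem_edges _ hep
    have hb := Walk.snd_mem_support_of_mem_edges _ hep
    rcases he with he | he
    · exact hne ((hcp a (Walk.fst_mem_support_of_mem_edges _ he) ha).trans
        (hcp b (Walk.snd_mem_support_of_mem_edges _ he) hb).symm)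
    · exact hne ((hdp a (Walk.fst_mem_support_of_mem_edges _ he) ha).trans
        (hdp b (Walk.snd_mem_support_of_mem_edges _ he) hb).symm)
  have hlp := Walk.not_nil_iff_lt_length.1 (Walk.not_nil_of_ne (p := p) huv)
  rw [Set.ncard_union_eq hdisj', Set.ncard_union_eq hdisj, ncard_edgeSet_walk hc.isTrail,
    ncard_edgeSet_walk hd.isTrail, ncard_edgeSet_walk hp.isTrail]
  have hu : u ∈ c.support.tail := Walk.end_mem_tail_support hc.not_nil
  have hv : v ∈ d.support.tail := Walk.end_mem_tail_support hd.not_nil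
  have hsub : edgeEnds (c.edgeSet ∪ d.edgeSet ∪ p.edgeSet) ⊆
      {x | x ∈ c.support.tail ++ (d.support.tail ++ p.support.tail.dropLast)} := by
    rw [edgeEnds_union, edgeEnds_union]
    rintro x ((hx | hx) | hx)
    · have := mem_support_of_mem_edgeEnds hx
      rw [Walk.mem_support_iff] at this
      rcases this with rfl | h
      · simp [hu]
      · simp [h]
    · have := mem_support_of_mem_edgeEnds hx
      rw [Walk.mem_support_iff] at this
      rcases this with rfl | h
      · simp [hv]
      · simp [h]
    · rcases mem_interior (mem_support_of_mem_edgeEnds hx) with rfl | rfl | h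
      · simp [hu]
      · simp [hv]
      · simp [h]
  have h1 := (Set.ncard_le_ncard hsub (Set.toFinite _)).trans (ncard_list_le _)
  simp only [List.length_append, List.length_dropLast, List.length_tail, Walk.length_support] at h1
  omega

theorem edgeEnds_lt_bicycle {V : Type*} [Finite V] {G : SimpleGraph V} {C : Set (Sym2 V)}
    (h : G.IsBicycleEdgeSet C) : (edgeEnds C).ncard < C.ncard := by
  rcases h with h | h | h
  · exact edgeEnds_lt_theta h
  · exact edgeEnds_lt_tight h
  · exact edgeEnds_lt_loose h

theorem IsBicycleEdgeSet.mono {V : Type*} {G H : SimpleGraph V} {C : Set (Sym2 V)}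
    (hle : G ≤ H) (h : G.IsBicycleEdgeSet C) : H.IsBicycleEdgeSet C := by
  rcases h with ⟨u, v, p, q, r, huv, hp, hq, hr, h⟩ | ⟨u, c, d, hc, hd, h⟩ |
    ⟨u, v, c, d, p, hc, hd, hp, h⟩
  · exact Or.inl ⟨u, v, p.mapLe hle, q.mapLe hle, r.mapLe hle, huv, hp.mapLe hle, hq.mapLe hle,
      hr.mapLe hle, by
        simpa only [Walk.edgeSet_mapLe_eq_edgeSet, Walk.support_mapLe_eq_support] using h⟩
  · exact Or.inr (Or.inl ⟨u, c.mapLe hle, d.mapLe hle, hc.mapLe hle, hd.mapLe hle, by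
        simpa only [Walk.edgeSet_mapLe_eq_edgeSet, Walk.support_mapLe_eq_support] using h⟩)
  · exact Or.inr (Or.inr ⟨u, v, c.mapLe hle, d.mapLe hle, p.mapLe hle, hc.mapLe hle, hd.mapLe hle,
      hp.mapLe hle, by
        simpa only [Walk.edgeSet_mapLe_eq_edgeSet, Walk.support_mapLe_eq_support] using h⟩)

/-- A longest path that starts with the edge `ux` and avoids `A`. -/
theorem exists_maximal_path {V : Type*} [Finite V] {H : SimpleGraph V}
    (hdeg : ∀ v x, H.Adj v x → ∃ y, y ≠ x ∧ H.Adj v y) (A : Set V) {u x : V} (hux : H.Adj u x)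
    (hu : u ∉ A) (hx : x ∉ A) :
    ∃ (w : V) (p : H.Walk u w), p.IsPath ∧ w ≠ u ∧ (∀ z ∈ p.support, z ∉ A) ∧
      ∃ y, H.Adj w y ∧ s(w, y) ∉ p.edges ∧ (y ∈ p.support ∨ y ∈ A) := by
  classical
  have := Fintype.ofFinite V
  let P : ℕ → Prop := fun n => ∃ (w : V) (p : H.Walk u w), p.IsPath ∧ ¬ p.Nil ∧
    (∀ z ∈ p.support, z ∉ A) ∧ p.length = n
  have hP1 : P 1 := by
    refine ⟨x, hux.toWalk, ?_, by simp, ?_, by simp⟩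
    · simp [hux.ne]
    · simp [hu, hx]
  have hb : ∀ n, P n → n ≤ Fintype.card V := by
    rintro n ⟨w, p, hp, -, -, rfl⟩
    exact hp.length_lt.le
  obtain ⟨w, p, hp, hnil, hA, hlen⟩ := Nat.findGreatest_spec (hb 1 hP1) hP1
  have hmax : ∀ k, P k → k ≤ p.length := fun k hk => by
    rw [hlen]; exact Nat.le_findGreatest (hb k hk) hk
  obtain ⟨y, hy, hwy⟩ := hdeg w p.penultimate (p.adj_penultimate hnil).symm
  refine ⟨w, p, hp, ?_, hA, y, hwy, fun h => hy (hp.eq_penultimate_of_mem_edges h), ?_⟩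
  · rintro rfl
    exact hnil (Walk.isPath_iff_nil.1 hp)
  · by_contra! hcon
    have h1 := hmax (p.length + 1) ⟨y, p.concat hwy, hp.concat hcon.1 hwy, by
      rw [Walk.not_nil_iff_lt_length]; simp, ?_, by simp⟩
    · omega
    · intro z hz
      rw [Walk.support_concat] at hz
      simp only [List.mem_append, List.mem_singleton] at hz
      rcases hz with hz | rfl
      · exact hA z hz
      · exact hcon.2

theorem handcuff_of_lollipop {V : Type*} {H : SimpleGraph V} {u v : V} {c : H.Walk u u}
    {d : H.Walk v v} {p : H.Walk u v} (hc : c.IsCycle) (hd : d.IsCycle) (hp : p.IsPath)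
    (hcd : ∀ x ∈ c.support, x ∈ d.support → x = u ∧ x = v)
    (hcp : ∀ x ∈ c.support, x ∈ p.support → x = u)
    (hdp : ∀ x ∈ d.support, x ∈ p.support → x = v) :
    H.IsBicycleEdgeSet (c.edgeSet ∪ d.edgeSet ∪ p.edgeSet) := by
  by_cases huv : u = v
  · subst huv
    rw [Walk.eq_nil_iff_nil.2 (Walk.isPath_iff_nil.1 hp)]
    refine Or.inr (Or.inl ⟨u, c, d, hc, hd, fun x h1 h2 => (hcd x h1 h2).1, by simp⟩)
  · refine Or.inr (Or.inr ⟨u, v, c, d, p, hc, hd, hp, fun x h1 h2 => ?_, hcp, hdp, rfl⟩)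
    have := hcd x h1 h2
    exact huv (this.1.symm.trans this.2)

theorem theta_of_ear {V : Type*} {H : SimpleGraph V} {u v : V} {c : H.Walk u u}
    {r : H.Walk u v} (hc : c.IsCycle) (hr : r.IsPath) (huv : u ≠ v) (hv : v ∈ c.support)
    (hcr : ∀ x ∈ c.support, x ∈ r.support → x = u ∨ x = v)
    (hdisj : Disjoint c.edgeSet r.edgeSet) :
    H.IsBicycleEdgeSet (c.edgeSet ∪ r.edgeSet) := by
  classical
  have hspec := c.take_spec hv
  set p := c.takeUntil v hv with hpdef
  set q := c.dropUntil v hv with hqdef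
  have hp : p.IsPath := hc.isPath_takeUntil hv
  have hpn : ¬ p.Nil := Walk.not_nil_of_ne huv
  have hq : q.IsPath := by
    rw [← hspec] at hc
    exact hc.isPath_of_append_right hpn
  have hedges : c.edgeSet = p.edgeSet ∪ q.edgeSet := by
    ext e
    rw [← hspec]
    simp [Walk.mem_edgeSet]
  have hnd := hc.support_nodup
  rw [← hspec, Walk.tail_support_append, List.nodup_append] at hnd
  have hpq : ∀ x ∈ p.support, x ∈ q.support → x = u ∨ x = v := by
    intro x hxp hxq
    rw [Walk.mem_support_iff] at hxp hxq
    rcases hxp with rfl | hxp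
    · exact Or.inl rfl
    rcases hxq with rfl | hxq
    · exact Or.inr rfl
    exact absurd rfl (hnd.2.2 x hxp x hxq)
  have hpc : ∀ x ∈ p.support, x ∈ c.support := fun x hx =>
    c.support_takeUntil_subset_support hv hx
  have hqc : ∀ x ∈ q.support, x ∈ c.support := fun x hx =>
    c.support_dropUntil_subset_support hv hx
  rw [hedges, Set.disjoint_union_left] at hdisj
  refine Or.inl ⟨u, v, p, q.reverse, r, huv, hp, hq.reverse, hr, ?_, hdisj.1, ?_, ?_, ?_, ?_, ?_⟩
  · rw [Set.disjoint_left]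
    intro e he he'
    rw [Walk.mem_edgeSet] at he he'
    rw [Walk.edges_reverse, List.mem_reverse] at he'
    exact hc.isTrail.disjoint_edges_takeUntil_dropUntil hv he he'
  · rw [Walk.edgeSet_reverse]; exact hdisj.2
  · intro x h1 h2
    exact hpq x h1 (by simpa using h2)
  · exact fun x h1 h2 => hcr x (hpc x h1) h2
  · exact fun x h1 h2 => hcr x (hqc x (by simpa using h1)) h2
  · rw [Walk.edgeSet_reverse, hedges]

/-- A path `p` from `u` to `w` and an edge from `w` back to a vertex of `p` contain a cycle. -/
theorem cycle_of_lasso {V : Type*} [DecidableEq V] {H : SimpleGraph V} {u w y : V}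
    {p : H.Walk u w} (hp : p.IsPath) (hwy : H.Adj w y) (he : s(w, y) ∉ p.edges)
    (hy : y ∈ p.support) :
    ∃ d : H.Walk y y, d.IsCycle ∧ (∀ x ∈ d.support, x ∈ p.support) ∧
      ∀ x ∈ d.support, x ∈ (p.takeUntil y hy).support → x = y := by
  have hd : (Walk.cons hwy (p.dropUntil y hy)).IsCycle := by
    rw [Walk.cons_isCycle_iff]
    exact ⟨hp.dropUntil hy, fun h => he (p.edges_dropUntil_subset_edges hy h)⟩
  have hyd : y ∈ (Walk.cons hwy (p.dropUntil y hy)).support := by simp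
  have hmem : ∀ x, x ∈ ((Walk.cons hwy (p.dropUntil y hy)).rotate y hyd).support →
      x ∈ (p.dropUntil y hy).support := by
    intro x hx
    rw [Walk.mem_support_rotate_iff] at hx
    rw [Walk.support_cons, List.mem_cons] at hx
    rcases hx with rfl | hx
    · exact Walk.end_mem_support _
    · exact hx
  refine ⟨_, hd.rotate hyd, fun x hx => p.support_dropUntil_subset_support hy (hmem x hx), ?_⟩
  intro x hx hx'
  have hx := hmem x hx
  have hnd := hp.support_nodup
  rw [← p.take_spec hy, Walk.support_append, List.nodup_append] at hnd
  rw [Walk.mem_support_iff] at hx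
  rcases hx with rfl | hx
  · rfl
  · exact absurd rfl (hnd.2.2 x hx' x hx)

theorem exists_bicycle_of_minimal {V : Type*} [Finite V] {C : Set (Sym2 V)}
    (hdiag : ∀ e ∈ C, ¬ e.IsDiag) (hC : (edgeEnds C).ncard < C.ncard)
    (hmin : ∀ D, D ⊂ C → D.ncard ≤ (edgeEnds D).ncard) :
    ∃ D ⊆ C, (fromEdgeSet C).IsBicycleEdgeSet D := by
  classical
  set H := fromEdgeSet C with hH
  have hedge : H.edgeSet = C := by
    rw [hH, edgeSet_fromEdgeSet]
    exact sdiff_eq_left.2 (Set.disjoint_left.2 fun e he he' => hdiag e he he')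
  have hadj : ∀ {a b}, H.Adj a b ↔ s(a, b) ∈ C := fun {a b} => by rw [← hedge, mem_edgeSet]
  have hsubw : ∀ {a b : V} (p : H.Walk a b), p.edgeSet ⊆ C := fun p e he =>
    hedge ▸ p.edges_subset_edgeSet he
  have hdeg : ∀ v x, H.Adj v x → ∃ y, y ≠ x ∧ H.Adj v y := by
    intro v x hvx
    by_contra! hcon
    have hmem : s(v, x) ∈ C := hadj.1 hvx
    have h1 := hmin (C \ {s(v, x)}) ⟨Set.sdiff_subset, fun h => (h hmem).2 rfl⟩
    have h2 := Set.ncard_sdiff_singleton_add_one hmem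
    have hv : v ∈ edgeEnds C := ⟨_, hmem, by simp⟩
    have h3 := Set.ncard_sdiff_singleton_add_one hv
    have h4 : edgeEnds (C \ {s(v, x)}) ⊆ edgeEnds C \ {v} := by
      rintro z ⟨e, he, hze⟩
      refine ⟨⟨e, he.1, hze⟩, ?_⟩
      rintro rfl
      obtain ⟨y, rfl⟩ := hze
      by_cases hyx : y = x
      · subst hyx; exact he.2 rfl
      · exact hcon y hyx (hadj.2 he.1)
    have h5 := Set.ncard_le_ncard h4
    omega
  -- a first cycle
  obtain ⟨u₀, c₀, hc₀⟩ : ∃ (u : V) (c : H.Walk u u), c.IsCycle := by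
    obtain ⟨e, he⟩ : C.Nonempty := by
      rw [← Set.ncard_pos]; omega
    induction e using Sym2.ind with | _ a b
    obtain ⟨w, p, hp, -, -, y, hwy, hne, hy⟩ :=
      exists_maximal_path hdeg ∅ (hadj.2 he) (by simp) (by simp)
    have hy : y ∈ p.support := by simpa using hy
    obtain ⟨d, hd, -⟩ := cycle_of_lasso hp hwy hne hy
    exact ⟨y, d, hd⟩
  -- an edge outside of the cycle with an end on it
  obtain ⟨u, x, hu, hux, hout⟩ : ∃ u x, u ∈ c₀.support ∧ H.Adj u x ∧ s(u, x) ∉ c₀.edgeSet := by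
    by_contra! hcon
    have hcC := hsubw c₀
    have hss : C \ c₀.edgeSet ⊂ C := by
      obtain ⟨e, he⟩ := List.exists_mem_of_ne_nil c₀.edges (by simpa using hc₀.not_nil)
      exact ⟨Set.sdiff_subset, fun h => (h (hcC he)).2 he⟩
    have h1 := hmin _ hss
    have h2 := Set.ncard_sdiff_add_ncard_of_subset hcC
    have h3 := ncard_edgeSet_walk hc₀.isTrail
    have h4 : c₀.length ≤ {z | z ∈ c₀.support}.ncard := by
      have : (c₀.support.tail.toFinset : Set V) ⊆ {z | z ∈ c₀.support} := by
        intro z hz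
        simp only [List.coe_toFinset] at hz
        exact List.mem_of_mem_tail hz
      have h := Set.ncard_le_ncard this
      rw [Set.ncard_coe_finset, List.toFinset_card_of_nodup hc₀.support_nodup] at h
      simpa using h
    have hd : Disjoint {z | z ∈ c₀.support} (edgeEnds (C \ c₀.edgeSet)) := by
      rw [Set.disjoint_left]
      rintro z hz ⟨e, he, hze⟩
      obtain ⟨y, rfl⟩ := hze
      exact he.2 (hcon z y hz (hadj.2 he.1))
    have h5 : {z | z ∈ c₀.support} ∪ edgeEnds (C \ c₀.edgeSet) ⊆ edgeEnds C := by
      apply Set.union_subset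
      · intro z hz
        obtain ⟨e, he, hze⟩ := (Walk.mem_support_iff_exists_mem_edges_of_not_nil hc₀.not_nil).1 hz
        exact ⟨e, hcC he, hze⟩
      · exact edgeEnds_mono Set.sdiff_subset
    have h6 := Set.ncard_le_ncard h5
    rw [Set.ncard_union_eq hd] at h6
    omega
  -- let the cycle start at `u`
  obtain ⟨c, hc, hcs, hce⟩ : ∃ c : H.Walk u u, c.IsCycle ∧
      (∀ z, z ∈ c.support ↔ z ∈ c₀.support) ∧ c.edgeSet = c₀.edgeSet :=
    ⟨c₀.rotate u hu, hc₀.rotate hu, fun z => Walk.mem_support_rotate_iff .., by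
      ext e; exact (c₀.rotate_edges u hu).mem_iff⟩
  rw [← hce] at hout
  by_cases hx : x ∈ c.support
  · refine ⟨c.edgeSet ∪ hux.toWalk.edgeSet, Set.union_subset (hsubw _) (hsubw _),
      theta_of_ear hc (by simp [hux.ne]) hux.ne hx ?_ ?_⟩
    · intro z _ hz; simpa using hz
    · rw [Set.disjoint_left]
      intro e he he'
      have : e = s(u, x) := by simpa [Walk.mem_edgeSet] using he'
      exact hout (this ▸ he)
  · obtain ⟨w, p, hp, hwu, hA, y, hwy, hne, hy⟩ :=
      exists_maximal_path hdeg {z | z ∈ c.support ∧ z ≠ u} hux (by simp) (by simp [hx])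
    have hcp : ∀ z ∈ c.support, z ∈ p.support → z = u := by
      intro z hz hz'
      by_contra h
      exact hA z hz' ⟨hz, h⟩
    by_cases hyp : y ∈ p.support
    · obtain ⟨d, hd, hds, hdt⟩ := cycle_of_lasso hp hwy hne hyp
      refine ⟨_, Set.union_subset (Set.union_subset (hsubw c) (hsubw d))
        (hsubw (p.takeUntil y hyp)),
        handcuff_of_lollipop hc hd (hp.takeUntil hyp) ?_ ?_ hdt⟩
      · intro z hz hz'
        have := hcp z hz (hds z hz')
        subst this
        exact ⟨rfl, hdt z hz' (Walk.start_mem_support _)⟩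
      · exact fun z hz hz' => hcp z hz (p.support_takeUntil_subset_support hyp hz')
    · obtain ⟨hyc, hyu⟩ := hy.resolve_left hyp
      have hsup : ∀ z ∈ c.support, z ∈ (p.concat hwy).support → z = u ∨ z = y := by
        intro z hz hz'
        rw [Walk.support_concat] at hz'
        simp only [List.mem_append, List.mem_singleton] at hz'
        rcases hz' with hz' | hz'
        · exact Or.inl (hcp z hz hz')
        · exact Or.inr hz'
      refine ⟨c.edgeSet ∪ (p.concat hwy).edgeSet, Set.union_subset (hsubw _) (hsubw _),
        theta_of_ear hc (hp.concat hyp hwy) hyu.symm hyc hsup ?_⟩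
      rw [Set.disjoint_left]
      intro e he he'
      rw [Walk.mem_edgeSet, Walk.edges_concat] at he'
      simp only [List.concat_eq_append, List.mem_append, List.mem_singleton] at he'
      rcases he' with he' | rfl
      · induction e using Sym2.ind with | _ a b
        have ha := hcp a (Walk.fst_mem_support_of_mem_edges _ he)
          (Walk.fst_mem_support_of_mem_edges _ he')
        have hb := hcp b (Walk.snd_mem_support_of_mem_edges _ he)
          (Walk.snd_mem_support_of_mem_edges _ he')
        exact (c.adj_of_mem_edges he).ne (ha.trans hb.symm)
      · exact hwu (hcp w (Walk.fst_mem_support_of_mem_edges _ he) (Walk.end_mem_support _))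

/-- A set of edges contains no bicycle exactly when each of its subsets has at most as many edges
as end vertices. -/
theorem bicycleFree_iff {V : Type*} [Finite V] {G : SimpleGraph V} {I : Set (Sym2 V)}
    (hI : I ⊆ G.edgeSet) :
    (∀ C ⊆ I, ¬ G.IsBicycleEdgeSet C) ↔ ∀ C ⊆ I, C.ncard ≤ (edgeEnds C).ncard := by
  constructor
  · intro h
    by_contra! hcon
    obtain ⟨C, ⟨hCI, hC⟩, hmin⟩ := exists_minimal_of_wellFoundedLT
      (fun C => C ⊆ I ∧ (edgeEnds C).ncard < C.ncard) hcon
    have hCG : C ⊆ G.edgeSet := hCI.trans hI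
    obtain ⟨D, hDC, hD⟩ := exists_bicycle_of_minimal
      (fun e he => G.not_isDiag_of_mem_edgeSet (hCG he)) hC (by
        intro D hD
        by_contra! hlt
        exact hD.2 (hmin ⟨hD.1.trans hCI, hlt⟩ hD.1))
    refine h D (hDC.trans hCI) (hD.mono ?_)
    intro a b hab
    exact hCG ((fromEdgeSet_adj C).1 hab).1
  · intro h C hC hb
    exact absurd (edgeEnds_lt_bicycle hb) (h C hC).not_gt

theorem exists_insert_sparse {V : Type*} [Finite V] {I J : Set (Sym2 V)}
    (hI : ∀ C ⊆ I, C.ncard ≤ (edgeEnds C).ncard) (hJ : ∀ C ⊆ J, C.ncard ≤ (edgeEnds C).ncard)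
    (hlt : I.ncard < J.ncard) :
    ∃ e ∈ J, e ∉ I ∧ ∀ C ⊆ insert e I, C.ncard ≤ (edgeEnds C).ncard := by
  by_contra! hcon
  -- the largest subset of `I` with equality
  obtain ⟨T, ⟨hTI, hT⟩, hmax⟩ := exists_maximal_of_wellFoundedGT
    (fun T : Set (Sym2 V) => T ⊆ I ∧ (edgeEnds T).ncard = T.ncard) ⟨∅, by simp [edgeEnds]⟩
  have hbig : ∀ S ⊆ I, (edgeEnds S).ncard = S.ncard → S ⊆ T := by
    intro S hSI hS
    have h1 := hI (S ∪ T) (Set.union_subset hSI hTI)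
    have h2 := hI (S ∩ T) (Set.inter_subset_left.trans hSI)
    have h3 : (edgeEnds (S ∩ T)).ncard ≤ (edgeEnds S ∩ edgeEnds T).ncard :=
      Set.ncard_le_ncard (Set.subset_inter (edgeEnds_mono Set.inter_subset_left)
        (edgeEnds_mono Set.inter_subset_right))
    have h4 := Set.ncard_union_add_ncard_inter (edgeEnds S) (edgeEnds T)
    have h5 := Set.ncard_union_add_ncard_inter S T
    rw [← edgeEnds_union] at h4
    exact Set.subset_union_left.trans
      (hmax ⟨Set.union_subset hSI hTI, by omega⟩ Set.subset_union_right)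
  have hends : ∀ e ∈ J, e ∉ I → ∀ v ∈ e, v ∈ edgeEnds T := by
    intro e heJ heI v hv
    obtain ⟨K, hK, hKlt⟩ := hcon e heJ heI
    have heK : e ∈ K := by
      by_contra h
      have : K ⊆ I := fun f hf => (hK hf).resolve_left (fun h' => h (h' ▸ hf))
      exact absurd (hI K this) hKlt.not_ge
    have hKI : K \ {e} ⊆ I := fun f hf => (hK hf.1).resolve_left hf.2
    have h1 := hI _ hKI
    have h2 := Set.ncard_sdiff_singleton_add_one heK
    have hsub : edgeEnds (K \ {e}) ⊆ edgeEnds K := edgeEnds_mono Set.sdiff_subset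
    have h3 := Set.ncard_le_ncard hsub
    have heq : edgeEnds (K \ {e}) = edgeEnds K := Set.eq_of_subset_of_ncard_le hsub (by omega)
    have := hbig _ hKI (by omega)
    exact edgeEnds_mono this (heq ▸ ⟨e, heK, hv⟩)
  let L : Set (Sym2 V) := {e ∈ J | ∀ v ∈ e, v ∈ edgeEnds T}
  have hL : L.ncard ≤ T.ncard := by
    rw [← hT]
    refine (hJ L (fun e he => he.1)).trans (Set.ncard_le_ncard ?_)
    rintro v ⟨e, he, hv⟩
    exact he.2 v hv
  have hcov : J ⊆ (I \ T) ∪ L := by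
    intro e he
    by_cases heI : e ∈ I
    · by_cases heT : e ∈ T
      · exact Or.inr ⟨he, fun v hv => ⟨e, heT, hv⟩⟩
      · exact Or.inl ⟨heI, heT⟩
    · exact Or.inr ⟨he, hends e he heI⟩
  have h1 := Set.ncard_le_ncard hcov
  have h2 := Set.ncard_union_le (I \ T) L
  have h3 := Set.ncard_sdiff_add_ncard_of_subset hTI
  omega

/-- The bicircular matroid `B(G)` of a finite simple graph: its ground set is the edge set of `G`,
and a set of edges is dependent when it contains a bicycle of `G`. -/
def bicircularMatroid {V : Type*} [Finite V] (G : SimpleGraph V) : Matroid (Sym2 V) :=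
  (IndepMatroid.ofFinite (E := G.edgeSet) (Set.toFinite _)
    (fun I => I ⊆ G.edgeSet ∧ ∀ C ⊆ I, ¬ G.IsBicycleEdgeSet C)
    ⟨Set.empty_subset _, by
      rw [bicycleFree_iff (Set.empty_subset _)]
      intro C hC
      rw [Set.subset_empty_iff.1 hC]
      simp⟩
    (fun _ _ hJ hIJ => ⟨hIJ.trans hJ.1, fun C hC => hJ.2 C (hC.trans hIJ)⟩)
    (by
      rintro I J ⟨hI, hI'⟩ ⟨hJ, hJ'⟩ hlt
      rw [bicycleFree_iff hI] at hI'
      rw [bicycleFree_iff hJ] at hJ'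
      obtain ⟨e, heJ, heI, h⟩ := exists_insert_sparse hI' hJ' hlt
      have hs : insert e I ⊆ G.edgeSet := Set.insert_subset (hJ heJ) hI
      exact ⟨e, heJ, heI, hs, (bicycleFree_iff hs).2 h⟩)
    (fun _ h => h.1)).matroid

end SimpleGraph

namespace Matroid

/-- An automorphism of a matroid: a bijection of the ground set that preserves circuits. -/
def IsAutomorphism {α : Type*} (M : Matroid α) (φ : Equiv.Perm M.E) : Prop :=
  ∀ C : Set M.E, M.IsCircuit (Subtype.val '' (φ '' C)) ↔ M.IsCircuit (Subtype.val '' C)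

/-- A fixing set of a matroid: the only automorphism that fixes it pointwise is the identity. -/
def IsFixingSet {α : Type*} (M : Matroid α) (S : Set M.E) : Prop :=
  ∀ φ : Equiv.Perm M.E, M.IsAutomorphism φ → (∀ x ∈ S, φ x = x) → φ = 1

/-- The fixing number of a matroid: the least size of a fixing set. -/
noncomputable def fixingNumber {α : Type*} (M : Matroid α) : ℕ∞ :=
  sInf {r : ℕ∞ | ∃ S : Set M.E, M.IsFixingSet S ∧ S.encard = r}

end Matroid

/-! ### Overfull cell sets in a square grid -/

/-! An edge of $K_{n,n}$ is a cell of the $n \times n$ grid, and the ends of a set of edges are the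
rows and columns that its cells meet. A set of edges is independent in the cycle matroid iff each
nonempty subset has more ends than edges, and in the bicircular matroid iff each subset has at least
as many ends as edges. So the circuits of both are the minimal overfull sets, with slack `c = 1` and
`c = 0` respectively (`isCircuit_iff_minimal_overfull`), and one argument on the grid treats both.

Upper bound for $n > 2$: an automorphism preserves the circuits of each size, in particular those
with `2 * k` cells, where `k = 2` for `c = 1` and `k = 3` for `c = 0`. These are exactly the $2
\times k$ and $k \times 2$ rectangles (`minimal_overfull_iff_isTwoByRect`), and they determine which
cells share a row or column (`exists_forced_cell_iff`). Automorphisms therefore preserve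
collinearity, and one that fixes $n - 1$ diagonal cells and one suitable further cell is trivial
(`eq_one_of_fixes_diagonal`).

Lower bound: for fewer than $n$ cells, either two rows or two columns are unused and can be swapped,
or the cells form a partial permutation matrix; extended to a permutation `σ`, it is fixed by the
reflection $(i, j) \mapsto (\sigma^{-1} j, \sigma i)$ (`exists_preserving_ne_one`).

For $n = 2$ a circuit can only be the whole grid, so all permutations of the four cells are
automorphisms and three cells are needed. -/

/-- A nonempty set of cells of a grid is overfull, with slack `c`, when it meets fewer rows and
columns than it has cells, up to `c`. -/
def Overfull {α : Type*} (c : ℕ) (C : Set (α × α)) : Prop :=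
  C.Nonempty ∧ (Prod.fst '' C).ncard + (Prod.snd '' C).ncard < C.ncard + c

/-- `C` is a combinatorial rectangle with side lengths `2` and `k`. -/
def IsTwoByRect {α : Type*} (k : ℕ) (C : Set (α × α)) : Prop :=
  ∃ p q : Set α, C = p ×ˢ q ∧ (p.ncard = 2 ∧ q.ncard = k ∨ p.ncard = k ∧ q.ncard = 2)

/-- A permutation of the cells that preserves the minimal overfull sets. -/
def PreservesMinimalOverfull {α : Type*} (c : ℕ) (ψ : Equiv.Perm (α × α)) : Prop :=
  ∀ C : Set (α × α), Minimal (Overfull c) (ψ '' C) ↔ Minimal (Overfull c) C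

/-! ### Small circuits are rectangles, and rectangles determine collinearity -/

theorem subset_prod_image {α β : Type*} (C : Set (α × β)) :
    C ⊆ (Prod.fst '' C) ×ˢ (Prod.snd '' C) :=
  fun x hx => ⟨⟨x, hx, rfl⟩, ⟨x, hx, rfl⟩⟩

theorem ncard_le_mul_image {α β : Type*} [Finite α] [Finite β] (C : Set (α × β)) :
    C.ncard ≤ (Prod.fst '' C).ncard * (Prod.snd '' C).ncard := by
  rw [← Set.ncard_prod]
  exact Set.ncard_le_ncard (subset_prod_image C)

/-- A set meeting `p` rows and `q` columns has at most `p * q` cells. With `2 * k` cells and `p + q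
< 2 * k + c`, this leaves only the side lengths `2` and `k` and forces the box to be full. Below `2
* k` cells the two inequalities are incompatible, so these rectangles are minimal. -/
theorem minimal_overfull_iff_isTwoByRect {α : Type*} [Finite α] {c k : ℕ}
    (hk : k = 2 ∧ c = 1 ∨ k = 3 ∧ c = 0) {C : Set (α × α)} (hC : C.ncard = 2 * k) :
    Minimal (Overfull c) C ↔ IsTwoByRect k C := by
  constructor
  · rintro ⟨⟨hne, hlt⟩, -⟩
    have hle := ncard_le_mul_image C
    refine ⟨Prod.fst '' C, Prod.snd '' C, ?_, ?_⟩
    · refine Set.eq_of_subset_of_ncard_le (subset_prod_image C) ?_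
      rw [Set.ncard_prod]
      generalize (Prod.fst '' C).ncard = p at *
      generalize (Prod.snd '' C).ncard = q at *
      rw [hC] at *
      -- In both cases `p + q < 2 * k + c ≤ 6`, which leaves finitely many pairs to check.
      have hp : p ≤ 5 := by omega
      have hq : q ≤ 5 := by omega
      interval_cases p <;> interval_cases q <;> omega
    · generalize (Prod.fst '' C).ncard = p at *
      generalize (Prod.snd '' C).ncard = q at *
      rw [hC] at *
      have hp : p ≤ 5 := by omega
      have hq : q ≤ 5 := by omega
      interval_cases p <;> interval_cases q <;> omega
  · rintro ⟨p, q, rfl, hpq⟩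
    have hp : p.Nonempty := Set.nonempty_of_ncard_ne_zero (by omega)
    have hq : q.Nonempty := Set.nonempty_of_ncard_ne_zero (by omega)
    refine ⟨⟨hp.prod hq, ?_⟩, ?_⟩
    · rw [Set.fst_image_prod _ hq, Set.snd_image_prod hp, hC]
      omega
    · rintro D ⟨hne, hlt⟩ hD
      refine (Set.eq_of_subset_of_ncard_le hD ?_).ge
      rw [hC]
      by_contra! hsmall
      have hle := ncard_le_mul_image D
      have hpos := hne.ncard_pos
      generalize (Prod.fst '' D).ncard = p at *
      generalize (Prod.snd '' D).ncard = q at *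
      generalize D.ncard = d at *
      have hp : p ≤ 5 := by omega
      have hq : q ≤ 5 := by omega
      interval_cases p <;> interval_cases q <;> omega

/-- For `2 ≤ k ≤ 3` two cells are in different rows and columns exactly when a third cell lies in
all `2 × k` rectangles containing them. -/
theorem exists_forced_cell_iff {α : Type*} [Finite α] (hα : 3 ≤ Nat.card α) {k : ℕ}
    (hk : k = 2 ∨ k = 3) {x y : α × α} (hxy : x ≠ y) :
    (∃ g, g ≠ x ∧ g ≠ y ∧ ∀ C, IsTwoByRect k C → x ∈ C → y ∈ C → g ∈ C) ↔
      x.1 ≠ y.1 ∧ x.2 ≠ y.2 := by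
  obtain ⟨a, b⟩ := x
  obtain ⟨a', b'⟩ := y
  -- enlarging a set to a given size, and a point to a pair that avoids a given point
  have ext : ∀ (s : Set α) (m : ℕ), s.ncard ≤ m → m ≤ 3 → ∃ t, s ⊆ t ∧ t.ncard = m := by
    intro s m hs hm
    obtain ⟨t, hst, -, ht⟩ := Set.exists_subsuperset_card_eq (Set.subset_univ s) hs
      (by rw [Set.ncard_univ]; omega)
    exact ⟨t, hst, ht⟩
  have ext' : ∀ u v : α, v ≠ u → ∃ t : Set α, u ∈ t ∧ v ∉ t ∧ t.ncard = 2 := by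
    intro u v huv
    obtain ⟨t, hst, hts, ht⟩ := Set.exists_subsuperset_card_eq (s := {u}) (t := {v}ᶜ) (n := 2)
      (by simpa using huv) (by simp)
      (by have := Set.ncard_add_ncard_compl ({v} : Set α); rw [Set.ncard_singleton] at this; omega)
    exact ⟨t, by simpa using hst, fun h => hts h rfl, ht⟩
  constructor
  · rintro ⟨⟨c, d⟩, hgx, hgy, hg⟩
    constructor
    · rintro rfl
      simp only [ne_eq, Prod.mk.injEq, true_and, not_and] at hxy hgx hgy
      have hpair : ({b, b'} : Set α).ncard = 2 := Set.ncard_pair hxy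
      by_cases hc : c = a
      -- The third cell is in the common row: a rectangle with no columns besides the two given ones
      -- misses it.
      · obtain ⟨p, hap, hp⟩ := ext {a} k (by simp; omega) (by omega)
        have := (hg _ ⟨p, {b, b'}, rfl, Or.inr ⟨hp, hpair⟩⟩ (by simpa using hap)
          (by simpa using hap)).2
        simp only [Set.mem_insert_iff, Set.mem_singleton_iff] at this
        exact this.elim (hgx hc) (hgy hc)
      -- The third cell is in another row: choose two rows that avoid it. A third row is available
      -- because `3 ≤ Nat.card α`.
      · obtain ⟨p, hap, hcp, hp⟩ := ext' a c hc
        obtain ⟨q, hbq, hq⟩ := ext {b, b'} k (by omega) (by omega)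
        exact hcp (hg _ ⟨p, q, rfl, Or.inl ⟨hp, hq⟩⟩ ⟨hap, hbq (by simp)⟩ ⟨hap, hbq (by simp)⟩).1
    · rintro rfl
      simp only [ne_eq, Prod.mk.injEq, and_true] at hxy hgx hgy
      have hpair : ({a, a'} : Set α).ncard = 2 := Set.ncard_pair hxy
      by_cases hd : d = b
      · obtain ⟨q, hbq, hq⟩ := ext {b} k (by simp; omega) (by omega)
        have := (hg _ ⟨{a, a'}, q, rfl, Or.inl ⟨hpair, hq⟩⟩ (by simpa using hbq)
          (by simpa using hbq)).1
        simp only [Set.mem_insert_iff, Set.mem_singleton_iff] at this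
        exact this.elim (fun h => hgx ⟨h, hd⟩) (fun h => hgy ⟨h, hd⟩)
      · obtain ⟨q, hbq, hdq, hq⟩ := ext' b d hd
        obtain ⟨p, hap, hp⟩ := ext {a, a'} k (by omega) (by omega)
        exact hdq (hg _ ⟨p, q, rfl, Or.inr ⟨hp, hq⟩⟩ ⟨hap (by simp), hbq⟩ ⟨hap (by simp), hbq⟩).2
  · rintro ⟨ha, hb⟩
    replace ha : a ≠ a' := ha
    replace hb : b ≠ b' := hb
    -- A rectangle containing two opposite corners contains the other corners too.
    refine ⟨(a, b'), fun h => hb (congrArg Prod.snd h).symm, fun h => ha (congrArg Prod.fst h), ?_⟩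
    rintro C ⟨p, q, rfl, -⟩ hx hy
    exact ⟨hx.1, hy.2⟩

theorem IsTwoByRect.ncard_eq {α : Type*} {k : ℕ} {C : Set (α × α)} (h : IsTwoByRect k C) :
    C.ncard = 2 * k := by
  obtain ⟨p, q, rfl, ⟨hp, hq⟩ | ⟨hp, hq⟩⟩ := h <;> rw [Set.ncard_prod, hp, hq]
  exact mul_comm _ _

/-- A permutation preserves cardinality, and among sets of `2 * k` cells the rectangles are the
minimal overfull ones. -/
theorem PreservesMinimalOverfull.isTwoByRect_image_iff {α : Type*} [Finite α] {c k : ℕ}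
    (hk : k = 2 ∧ c = 1 ∨ k = 3 ∧ c = 0) {ψ : Equiv.Perm (α × α)}
    (hψ : PreservesMinimalOverfull c ψ) (C : Set (α × α)) :
    IsTwoByRect k (ψ '' C) ↔ IsTwoByRect k C := by
  have hcard : (ψ '' C).ncard = C.ncard := Set.ncard_image_of_injective _ ψ.injective
  constructor <;> intro h <;> have hC := h.ncard_eq
  · rw [← minimal_overfull_iff_isTwoByRect hk (hcard ▸ hC), ← hψ,
      minimal_overfull_iff_isTwoByRect hk hC]
    exact h
  · rw [← minimal_overfull_iff_isTwoByRect hk (hcard.trans hC), hψ,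
      minimal_overfull_iff_isTwoByRect hk hC]
    exact h

/-- A permutation preserving the minimal overfull sets preserves collinearity of cells. -/
theorem PreservesMinimalOverfull.collinear_iff {α : Type*} [Finite α] (hα : 3 ≤ Nat.card α)
    {c k : ℕ} (hk : k = 2 ∧ c = 1 ∨ k = 3 ∧ c = 0) {ψ : Equiv.Perm (α × α)}
    (hψ : PreservesMinimalOverfull c ψ) (x y : α × α) :
    ((ψ x).1 = (ψ y).1 ∨ (ψ x).2 = (ψ y).2) ↔ (x.1 = y.1 ∨ x.2 = y.2) := by
  by_cases hxy : x = y
  · simp [hxy]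
  have hk' : k = 2 ∨ k = 3 := by omega
  have h1 := exists_forced_cell_iff hα hk' hxy
  have h2 := exists_forced_cell_iff hα hk' (ψ.injective.ne hxy)
  -- Non-collinearity is expressed through forced cells on both sides; the forced cell and the
  -- rectangles on the image side are then reindexed along `ψ`.
  rw [← not_iff_not, not_or, not_or, ← ne_eq, ← ne_eq, ← ne_eq, ← ne_eq, ← h1, ← h2,
    ← ψ.exists_congr_right]
  refine exists_congr fun g => ?_
  rw [ψ.injective.ne_iff, ψ.injective.ne_iff, (Set.image_surjective.2 ψ.surjective).forall]
  simp only [hψ.isTwoByRect_image_iff hk, ψ.injective.mem_set_image]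

/-! ### Rigidity of the grid -/

/-- A collinearity preserving permutation that fixes the diagonal cells other than the last one,
and one more cell of the first row, is the identity. -/
theorem eq_one_of_fixes_diagonal {n : ℕ} (hn : 2 < n) {ψ : Equiv.Perm (Fin n × Fin n)}
    (hψ : ∀ x y, ((ψ x).1 = (ψ y).1 ∨ (ψ x).2 = (ψ y).2) ↔ (x.1 = y.1 ∨ x.2 = y.2))
    (hdiag : ∀ i : Fin n, i.val + 1 < n → ψ (i, i) = (i, i))
    (h01 : ψ (⟨0, by omega⟩, ⟨1, by omega⟩) = (⟨0, by omega⟩, ⟨1, by omega⟩)) : ψ = 1 := by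
  let z : Fin n := ⟨0, by omega⟩
  let o : Fin n := ⟨1, by omega⟩
  have hzo : z ≠ o := by simp [z, o]
  change ψ (z, o) = (z, o) at h01
  have h00 : ψ (z, z) = (z, z) := hdiag z (by simp [z]; omega)
  have h11 : ψ (o, o) = (o, o) := hdiag o (by simp [o]; omega)
  have inj : ∀ x y, ψ x = ψ y → x = y := fun x y h => ψ.injective h
  -- Only `(o, z)` and `(z, o)` are collinear with both `(z, z)` and `(o, o)` among the cells off
  -- the diagonal; the fixed cell `(z, o)` decides between them.
  have h10 : ψ (o, z) = (o, z) := by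
    have a := (hψ (o, z) (z, z)).2 (Or.inr rfl)
    have b := (hψ (o, z) (o, o)).2 (Or.inl rfl)
    have c := (hψ (o, z) (z, o)).not.2 (by simp [hzo, hzo.symm])
    rw [h00] at a; rw [h11] at b; rw [h01] at c
    rw [not_or] at c
    exact Prod.ext (b.resolve_right c.2) (a.resolve_left c.1)
  -- A cell outside row `z` cannot be collinear with both `(z, z)` and `(z, o)`, as it would lie in
  -- two columns.
  have hrow : ∀ j, (ψ (z, j)).1 = z := by
    intro j
    have a := (hψ (z, j) (z, z)).2 (Or.inl rfl)
    have b := (hψ (z, j) (z, o)).2 (Or.inl rfl)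
    rw [h00] at a; rw [h01] at b
    exact a.elim id fun a => b.resolve_right fun b => hzo (a.symm.trans b)
  have hcol : ∀ i, (ψ (i, z)).2 = z := by
    intro i
    have a := (hψ (i, z) (z, z)).2 (Or.inr rfl)
    have b := (hψ (i, z) (o, z)).2 (Or.inr rfl)
    rw [h00] at a; rw [h10] at b
    exact a.elim (fun a => b.resolve_left fun b => hzo (a.symm.trans b)) id
  have hrow1 : ∀ j : Fin n, j.val + 1 < n → ψ (z, j) = (z, j) := by
    intro j hj
    by_cases hjz : z = j
    · rw [← hjz, h00]
    have a := (hψ (z, j) (j, j)).2 (Or.inr rfl)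
    rw [hdiag j hj, hrow j] at a
    exact Prod.ext (hrow j) (a.resolve_left hjz)
  have hcol1 : ∀ i : Fin n, i.val + 1 < n → ψ (i, z) = (i, z) := by
    intro i hi
    by_cases hiz : z = i
    · rw [← hiz, h00]
    have a := (hψ (i, z) (i, i)).2 (Or.inl rfl)
    rw [hdiag i hi, hcol i] at a
    exact Prod.ext (a.resolve_right hiz) (hcol i)
  -- The last cell of the row has no fixed diagonal cell in its column, but injectivity leaves it no
  -- other image in the row.
  have hrow2 : ∀ j : Fin n, ψ (z, j) = (z, j) := by
    intro j
    by_cases hj : j.val + 1 < n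
    · exact hrow1 j hj
    by_cases h : (ψ (z, j)).2.val + 1 < n
    · have a := hrow1 _ h
      have b : (z, (ψ (z, j)).2) = ψ (z, j) := Prod.ext (hrow j).symm rfl
      have c := inj _ _ (a.trans b)
      simp only [Prod.mk.injEq, true_and] at c
      rw [c] at h
      exact absurd h hj
    · refine Prod.ext (hrow j) (Fin.ext ?_)
      have := (ψ (z, j)).2.isLt
      have := j.isLt
      simp only
      omega
  have hcol2 : ∀ i : Fin n, ψ (i, z) = (i, z) := by
    intro i
    by_cases hi : i.val + 1 < n
    · exact hcol1 i hi
    by_cases h : (ψ (i, z)).1.val + 1 < n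
    · have a := hcol1 _ h
      have b : ((ψ (i, z)).1, z) = ψ (i, z) := Prod.ext rfl (hcol i).symm
      have c := inj _ _ (a.trans b)
      simp only [Prod.mk.injEq, and_true] at c
      rw [c] at h
      exact absurd h hi
    · refine Prod.ext (Fin.ext ?_) (hcol i)
      have := (ψ (i, z)).1.isLt
      have := i.isLt
      simp only
      omega
  ext1 ⟨i, j⟩
  rw [Equiv.Perm.one_apply]
  by_cases hi : i = z
  · rw [hi]; exact hrow2 j
  by_cases hj : j = z
  · rw [hj]; exact hcol2 i
  -- The image stays outside row `z` and column `z`, so its collinearity with `(i, z)` and `(z, j)`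
  -- gives its row and its column.
  have a := (hψ (i, j) (i, z)).2 (Or.inl rfl)
  have b := (hψ (i, j) (z, j)).2 (Or.inr rfl)
  have d := (hψ (i, j) (z, z)).not.2 (not_or.2 ⟨hi, hj⟩)
  rw [hcol2 i] at a
  rw [hrow2 j] at b
  rw [h00, not_or] at d
  exact Prod.ext (a.resolve_right d.2) (b.resolve_left d.1)

/-! ### Symmetries of the grid that fix few cells -/

/-- Overfullness sees only the cell count and the total of rows and columns, so a symmetry may
exchange the two directions. -/
theorem preservesMinimalOverfull_of_ncard {α : Type*} {c : ℕ} {ψ : Equiv.Perm (α × α)}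
    (h : ∀ C : Set (α × α), (Prod.fst '' (ψ '' C)).ncard + (Prod.snd '' (ψ '' C)).ncard =
      (Prod.fst '' C).ncard + (Prod.snd '' C).ncard) : PreservesMinimalOverfull c ψ := by
  have hover : ∀ C, Overfull c (ψ '' C) ↔ Overfull c C := by
    intro C
    rw [Overfull, Overfull, h, Set.image_nonempty, Set.ncard_image_of_injective _ ψ.injective]
  intro C
  constructor
  · rintro ⟨h1, h2⟩
    exact ⟨(hover C).1 h1, fun D hD hDC => (Set.image_subset_image_iff ψ.injective).1
      (h2 ((hover D).2 hD) (Set.image_mono hDC))⟩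
  · rintro ⟨h1, h2⟩
    refine ⟨(hover C).2 h1, fun D hD hDC => ?_⟩
    obtain ⟨D, rfl⟩ := Set.image_surjective.2 ψ.surjective D
    exact Set.image_mono (h2 ((hover D).1 hD) ((Set.image_subset_image_iff ψ.injective).1 hDC))

theorem preservesMinimalOverfull_prodCongr {α : Type*} (c : ℕ) (σ τ : Equiv.Perm α) :
    PreservesMinimalOverfull c (σ.prodCongr τ) := by
  refine preservesMinimalOverfull_of_ncard fun C => ?_
  have h1 : Prod.fst '' (σ.prodCongr τ '' C) = σ '' (Prod.fst '' C) := by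
    simp only [Set.image_image, Equiv.prodCongr_apply, Prod.map_fst]
  have h2 : Prod.snd '' (σ.prodCongr τ '' C) = τ '' (Prod.snd '' C) := by
    simp only [Set.image_image, Equiv.prodCongr_apply, Prod.map_snd]
  rw [h1, h2, Set.ncard_image_of_injective _ σ.injective,
    Set.ncard_image_of_injective _ τ.injective]

theorem preservesMinimalOverfull_prodComm {α : Type*} (c : ℕ) (σ τ : Equiv.Perm α) :
    PreservesMinimalOverfull c ((Equiv.prodComm α α).trans (σ.prodCongr τ)) := by
  refine preservesMinimalOverfull_of_ncard fun C => ?_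
  have h1 : Prod.fst '' ((Equiv.prodComm α α).trans (σ.prodCongr τ) '' C) =
      σ '' (Prod.snd '' C) := by
    simp only [Set.image_image, Equiv.trans_apply, Equiv.prodComm_apply, Equiv.prodCongr_apply,
      Prod.map_fst, Prod.fst_swap]
  have h2 : Prod.snd '' ((Equiv.prodComm α α).trans (σ.prodCongr τ) '' C) =
      τ '' (Prod.fst '' C) := by
    simp only [Set.image_image, Equiv.trans_apply, Equiv.prodComm_apply, Equiv.prodCongr_apply,
      Prod.map_snd, Prod.snd_swap]
  rw [h1, h2, Set.ncard_image_of_injective _ σ.injective,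
    Set.ncard_image_of_injective _ τ.injective, add_comm]

theorem exists_pair_notMem {α : Type*} [Finite α] {s : Set α} (h : s.ncard + 2 ≤ Nat.card α) :
    ∃ a b, a ≠ b ∧ a ∉ s ∧ b ∉ s := by
  have := Set.ncard_add_ncard_compl s
  obtain ⟨a, b, ha, hb, hab⟩ := (Set.one_lt_ncard_iff (s := sᶜ)).1 (by omega)
  exact ⟨a, b, hab, ha, hb⟩

/-- A set of cells no two of which share a row or a column lies on the graph of a permutation. -/
theorem exists_perm_extending {α : Type*} [Finite α] {T : Set (α × α)}
    (h1 : Set.InjOn Prod.fst T) (h2 : Set.InjOn Prod.snd T) :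
    ∃ σ : Equiv.Perm α, ∀ x ∈ T, σ x.1 = x.2 := by
  classical
  let e : {a // a ∈ Prod.fst '' T} ≃ {a // a ∈ Prod.snd '' T} :=
    (Equiv.Set.imageOfInjOn Prod.fst T h1).symm.trans (Equiv.Set.imageOfInjOn Prod.snd T h2)
  refine ⟨e.extendSubtype, fun x hx => ?_⟩
  rw [Equiv.extendSubtype_apply_of_mem e x.1 ⟨x, hx, rfl⟩]
  have : (Equiv.Set.imageOfInjOn Prod.fst T h1).symm ⟨x.1, x, hx, rfl⟩ = ⟨x, hx⟩ := by
    rw [Equiv.symm_apply_eq]; rfl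
  simp only [e, Equiv.trans_apply, this]
  rfl

/-- Fewer than `n` cells of an `n × n` grid are fixed by a nontrivial permutation of the cells that
preserves the minimal overfull sets. -/
theorem exists_preserving_ne_one {α : Type*} [Finite α] (hα : 2 ≤ Nat.card α) (c : ℕ)
    {T : Set (α × α)} (hT : T.encard < Nat.card α) :
    ∃ ψ : Equiv.Perm (α × α), PreservesMinimalOverfull c ψ ∧ (∀ x ∈ T, ψ x = x) ∧ ψ ≠ 1 := by
  classical
  have hT : T.ncard < Nat.card α := by
    rw [← (Set.toFinite T).cast_ncard_eq] at hT
    exact_mod_cast hT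
  -- A collision loses one more line, so at least two rows or columns are unused.
  have small : ∀ f : α × α → α, ¬ Set.InjOn f T → (f '' T).ncard + 2 ≤ Nat.card α := by
    intro f hf
    have h1 := Set.ncard_image_le (f := f) T.toFinite
    have h2 : (f '' T).ncard ≠ T.ncard := fun h => hf (Set.injOn_of_ncard_image_eq h)
    omega
  by_cases h1 : Set.InjOn Prod.fst T
  · by_cases h2 : Set.InjOn Prod.snd T
    · obtain ⟨σ, hσ⟩ := exists_perm_extending h1 h2
      -- The map $(i, j) \mapsto (\sigma^{-1} j, \sigma i)$ fixes precisely the cells with `j = σ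
      -- i`, so any cell off this graph shows that it is not the identity.
      refine ⟨_, preservesMinimalOverfull_prodComm c σ.symm σ, ?_, ?_⟩
      · rintro ⟨i, j⟩ hx
        have := hσ _ hx
        simp only at this
        simp [this, Equiv.symm_apply_eq]
      · intro h
        have : Nontrivial α := Finite.one_lt_card_iff_nontrivial.1 (by omega)
        obtain ⟨i⟩ := this.to_nonempty
        obtain ⟨j, hj⟩ := exists_ne (σ i)
        have := congrArg Prod.snd (Equiv.congr_fun h (i, j))
        simp at this
        exact hj this.symm
    · obtain ⟨a, b, hab, ha, hb⟩ := exists_pair_notMem (small _ h2)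
      refine ⟨_, preservesMinimalOverfull_prodCongr c 1 (Equiv.swap a b), ?_, ?_⟩
      · rintro ⟨i, j⟩ hx
        have h3 : j ≠ a := fun h => ha ⟨_, hx, h⟩
        have h4 : j ≠ b := fun h => hb ⟨_, hx, h⟩
        simp [Equiv.swap_apply_of_ne_of_ne h3 h4]
      · intro h
        have := congrArg Prod.snd (Equiv.congr_fun h (a, a))
        simp at this
        exact hab this.symm
  · obtain ⟨a, b, hab, ha, hb⟩ := exists_pair_notMem (small _ h1)
    refine ⟨_, preservesMinimalOverfull_prodCongr c (Equiv.swap a b) 1, ?_, ?_⟩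
    · rintro ⟨i, j⟩ hx
      have h3 : i ≠ a := fun h => ha ⟨_, hx, h⟩
      have h4 : i ≠ b := fun h => hb ⟨_, hx, h⟩
      simp [Equiv.swap_apply_of_ne_of_ne h3 h4]
    · intro h
      have := congrArg Prod.fst (Equiv.congr_fun h (a, a))
      simp at this
      exact hab this.symm

/-- In a `2 × 2` grid every permutation of the cells preserves the minimal overfull sets. -/
theorem preservesMinimalOverfull_two {c : ℕ} (hc : c ≤ 1) (ψ : Equiv.Perm (Fin 2 × Fin 2)) :
    PreservesMinimalOverfull c ψ := by
  have huniv : ∀ C : Set (Fin 2 × Fin 2), Minimal (Overfull c) C → C = Set.univ := by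
    -- For side counts `p, q ≤ 2` one has `p * q + c ≤ p + q` unless both equal `2`, and then all
    -- four cells are needed.
    rintro C ⟨⟨hne, hlt⟩, -⟩
    have hle := ncard_le_mul_image C
    have h1 : (Prod.fst '' C).ncard ≤ 2 := by simpa using Set.ncard_le_card (Prod.fst '' C)
    have h2 : (Prod.snd '' C).ncard ≤ 2 := by simpa using Set.ncard_le_card (Prod.snd '' C)
    have hpos := hne.ncard_pos
    refine Set.eq_of_subset_of_ncard_le (Set.subset_univ C) ?_
    rw [Set.ncard_univ, Nat.card_prod, Nat.card_fin]
    generalize (Prod.fst '' C).ncard = p at *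
    generalize (Prod.snd '' C).ncard = q at *
    interval_cases p <;> interval_cases q <;> omega
  intro C
  constructor <;> intro h
  · have hC : C = Set.univ := by
      have := huniv _ h
      rwa [← Set.image_univ_of_surjective ψ.surjective, ψ.injective.image_injective.eq_iff] at this
    rw [hC, Set.image_univ_of_surjective ψ.surjective] at h
    rwa [hC]
  · have hC := huniv _ h
    rw [hC] at h
    rwa [hC, Set.image_univ_of_surjective ψ.surjective]

theorem Equiv.Perm.eq_one_of_forall_ne {β : Type*} {ψ : Equiv.Perm β} (b : β)
    (h : ∀ x ≠ b, ψ x = x) : ψ = 1 := by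
  ext1 x
  by_cases hx : x = b
  · by_contra hne
    exact hne (ψ.injective (h _ fun h' => hne (h'.trans hx.symm)))
  · exact h x hx

/-! ### Fixing numbers of matroids whose circuits are the minimal overfull sets -/

/-- Conjugation by `e` identifies the automorphisms of `M` with the permutations of `β` preserving
`P`, so the computation can be done on `β`. -/
theorem Matroid.fixingNumber_eq {α β : Type*} {M : Matroid α} (e : β ≃ M.E) {P : Set β → Prop}
    (hP : ∀ C : Set β, M.IsCircuit (Subtype.val '' (e '' C)) ↔ P C) {k : ℕ∞}
    (hex : ∃ T : Set β, T.encard = k ∧ ∀ ψ : Equiv.Perm β, (∀ C, P (ψ '' C) ↔ P C) →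
      (∀ x ∈ T, ψ x = x) → ψ = 1)
    (hlow : ∀ T : Set β, T.encard < k → ∃ ψ : Equiv.Perm β, (∀ C, P (ψ '' C) ↔ P C) ∧
      (∀ x ∈ T, ψ x = x) ∧ ψ ≠ 1) :
    M.fixingNumber = k := by
  have haut : ∀ ψ : Equiv.Perm β,
      M.IsAutomorphism (e.permCongr ψ) ↔ ∀ C, P (ψ '' C) ↔ P C := by
    intro ψ
    rw [Matroid.IsAutomorphism, (Set.image_surjective.2 e.surjective).forall]
    refine forall_congr' fun C => ?_
    rw [← hP, ← hP]
    have : e.permCongr ψ '' (e '' C) = e '' (ψ '' C) := by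
      simp only [Set.image_image, Equiv.permCongr_apply, Equiv.symm_apply_apply]
    rw [this]
  have hfix : ∀ T : Set β, M.IsFixingSet (e '' T) ↔ ∀ ψ : Equiv.Perm β,
      (∀ C, P (ψ '' C) ↔ P C) → (∀ x ∈ T, ψ x = x) → ψ = 1 := by
    intro T
    rw [Matroid.IsFixingSet, e.permCongr.surjective.forall]
    refine forall_congr' fun ψ => ?_
    rw [haut, Set.forall_mem_image]
    have h1 : e.permCongr ψ = 1 ↔ ψ = 1 := by
      rw [← e.permCongr.injective.eq_iff (a := ψ) (b := 1)]
      simp [Equiv.Perm.one_def]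
    simp only [Equiv.permCongr_apply, Equiv.symm_apply_apply, e.injective.eq_iff, h1]
  apply le_antisymm
  · obtain ⟨T, hT, h⟩ := hex
    exact sInf_le ⟨e '' T, (hfix T).2 h, by rw [e.injective.encard_image, hT]⟩
  · refine le_sInf ?_
    rintro r ⟨S, hS, rfl⟩
    obtain ⟨T, rfl⟩ := (Set.image_surjective.2 e.surjective) S
    rw [hfix] at hS
    rw [e.injective.encard_image]
    by_contra! hlt
    obtain ⟨ψ, h1, h2, h3⟩ := hlow T hlt
    exact h3 (hS ψ h1 h2)

theorem Matroid.fixingNumber_eq_of_overfull {γ : Type*} {M : Matroid γ} {n c : ℕ} (hn : 2 < n)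
    (hc : c ≤ 1) (e : Fin n × Fin n ≃ M.E)
    (hM : ∀ C : Set (Fin n × Fin n),
      M.IsCircuit (Subtype.val '' (e '' C)) ↔ Minimal (Overfull c) C) :
    M.fixingNumber = n := by
  refine Matroid.fixingNumber_eq e hM ?_ ?_
  · let z : Fin n := ⟨0, by omega⟩
    let o : Fin n := ⟨1, by omega⟩
    let l : Fin n := ⟨n - 1, by omega⟩
    -- The diagonal alone is fixed by transposition, hence the extra cell `(z, o)`; dropping the
    -- last diagonal cell keeps the count at `n`.
    refine ⟨insert (z, o) ((fun i => (i, i)) '' {l}ᶜ), ?_, fun ψ hψ hfix => ?_⟩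
    · have hinj : Function.Injective fun i : Fin n => (i, i) := fun i j h => congrArg Prod.fst h
      rw [Set.encard_insert_of_notMem, hinj.encard_image, ← (Set.toFinite _).cast_ncard_eq]
      · have := Set.ncard_add_ncard_compl ({l} : Set (Fin n))
        rw [Set.ncard_singleton, Nat.card_fin] at this
        exact_mod_cast (add_comm _ _).trans this
      · rintro ⟨i, -, hi⟩
        have := (congrArg Prod.fst hi).symm.trans (congrArg Prod.snd hi)
        simp [z, o] at this
    · have hk : ∃ k, k = 2 ∧ c = 1 ∨ k = 3 ∧ c = 0 := by
        rcases (by omega : c = 1 ∨ c = 0) with h | h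
        exacts [⟨2, Or.inl ⟨rfl, h⟩⟩, ⟨3, Or.inr ⟨rfl, h⟩⟩]
      obtain ⟨k, hk⟩ := hk
      refine eq_one_of_fixes_diagonal hn
        (PreservesMinimalOverfull.collinear_iff (by rw [Nat.card_fin]; omega) hk hψ) ?_
        (hfix _ (Set.mem_insert _ _))
      intro i hi
      refine hfix _ (Set.mem_insert_of_mem _ ⟨i, fun h => ?_, rfl⟩)
      have : i.val = n - 1 := congrArg Fin.val h
      omega
  · intro T hT
    exact exists_preserving_ne_one (by rw [Nat.card_fin]; omega) c (by rwa [Nat.card_fin])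

theorem Matroid.fixingNumber_eq_three_of_overfull {γ : Type*} {M : Matroid γ} {c : ℕ}
    (hc : c ≤ 1) (e : Fin 2 × Fin 2 ≃ M.E)
    (hM : ∀ C : Set (Fin 2 × Fin 2),
      M.IsCircuit (Subtype.val '' (e '' C)) ↔ Minimal (Overfull c) C) :
    M.fixingNumber = 3 := by
  classical
  have hcard : Nat.card (Fin 2 × Fin 2) = 4 := by simp
  refine Matroid.fixingNumber_eq e hM ⟨{(0, 0)}ᶜ, ?_, fun ψ _ hfix => ?_⟩ ?_
  · have := Set.ncard_add_ncard_compl ({(0, 0)} : Set (Fin 2 × Fin 2))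
    rw [Set.ncard_singleton, hcard] at this
    rw [← (Set.toFinite _).cast_ncard_eq, (by omega : ({(0, 0)}ᶜ : Set (Fin 2 × Fin 2)).ncard = 3)]
    rfl
  · exact Equiv.Perm.eq_one_of_forall_ne (0, 0) hfix
  · intro T hT
    have hT : T.ncard < 3 := by
      rw [← (Set.toFinite T).cast_ncard_eq] at hT
      exact_mod_cast hT
    obtain ⟨a, b, hab, ha, hb⟩ := exists_pair_notMem (s := T) (by omega)
    refine ⟨Equiv.swap a b, preservesMinimalOverfull_two hc _, fun x hx => ?_, fun h => ?_⟩
    · exact Equiv.swap_apply_of_ne_of_ne (fun h => ha (h ▸ hx)) (fun h => hb (h ▸ hx))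
    · have := Equiv.congr_fun h a
      rw [Equiv.swap_apply_left] at this
      exact hab this.symm

/-! ### The matroids of the complete bipartite graph -/

namespace SimpleGraph

/-- The edges of a complete bipartite graph, as cells of a grid. -/
def cellEdge {V W : Type*} (x : V × W) : Sym2 (V ⊕ W) := s(Sum.inl x.1, Sum.inr x.2)

theorem cellEdge_injective {V W : Type*} : Function.Injective (cellEdge (V := V) (W := W)) := by
  rintro ⟨a, b⟩ ⟨a', b'⟩ h
  simpa [cellEdge] using h

theorem ncard_edgeEnds_image_cellEdge {V W : Type*} [Finite V] [Finite W] (C : Set (V × W)) :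
    (edgeEnds (cellEdge '' C)).ncard = (Prod.fst '' C).ncard + (Prod.snd '' C).ncard := by
  have : edgeEnds (cellEdge '' C) = Sum.inl '' (Prod.fst '' C) ∪ Sum.inr '' (Prod.snd '' C) := by
    ext v
    rcases v with v | v <;> simp [edgeEnds, cellEdge]
  rw [this, Set.ncard_union_eq, Set.ncard_image_of_injective _ Sum.inl_injective,
    Set.ncard_image_of_injective _ Sum.inr_injective]
  rw [Set.disjoint_left]
  rintro _ ⟨a, -, rfl⟩ ⟨b, -, h⟩
  exact Sum.inr_ne_inl h

/-- Dependent sets are those containing an overfull set, and a family and its upward closure have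
the same minimal members. -/
theorem isCircuit_iff_minimal_overfull {n c : ℕ} {M : Matroid (Sym2 (Fin n ⊕ Fin n))}
    (hE : M.E = (completeBipartiteGraph (Fin n) (Fin n)).edgeSet)
    (hI : ∀ I ⊆ M.E, M.Indep I ↔ ∀ C ⊆ I, C.Nonempty → C.ncard + c ≤ (edgeEnds C).ncard)
    (C : Set (Fin n × Fin n)) : M.IsCircuit (cellEdge '' C) ↔ Minimal (Overfull c) C := by
  have hsub : ∀ D : Set (Fin n × Fin n), cellEdge '' D ⊆ M.E := by
    intro D
    rw [hE, edgeSet_completeBipartiteGraph]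
    exact Set.image_subset_range _ _
  have hdep : ∀ D : Set (Fin n × Fin n),
      ¬ M.Indep (cellEdge '' D) ↔ ∃ D' ⊆ D, Overfull c D' := by
    intro D
    rw [hI _ (hsub D), Set.forall_subset_image_iff]
    simp only [Set.image_nonempty, ncard_edgeEnds_image_cellEdge,
      Set.ncard_image_of_injective _ cellEdge_injective, Overfull]
    push Not
    rfl
  rw [Matroid.isCircuit_iff_minimal_not_indep (hsub C)]
  constructor
  · rintro ⟨h, hmin⟩
    obtain ⟨D, hDC, hD⟩ := (hdep C).1 h
    have : ∀ D' ⊆ C, Overfull c D' → C ⊆ D' := fun D' hD' h' =>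
      (Set.image_subset_image_iff cellEdge_injective).1
        (hmin ((hdep D').2 ⟨D', subset_rfl, h'⟩) (Set.image_mono hD'))
    exact ⟨(hDC.antisymm (this D hDC hD)) ▸ hD, fun D' h' hD' => this D' hD' h'⟩
  · rintro ⟨h, hmin⟩
    refine ⟨(hdep C).2 ⟨C, subset_rfl, h⟩, fun I hI hIC => ?_⟩
    obtain ⟨D, hDC, rfl⟩ := Set.subset_image_iff.1 hIC
    obtain ⟨D', hD'D, hD'⟩ := (hdep D).1 hI
    exact Set.image_mono ((hmin hD' (hD'D.trans hDC)).trans hD'D)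

/-- The cells of the grid are the elements of a matroid on the edges of the complete bipartite
graph. -/
noncomputable def cellEquiv {n : ℕ} {M : Matroid (Sym2 (Fin n ⊕ Fin n))}
    (hE : M.E = (completeBipartiteGraph (Fin n) (Fin n)).edgeSet) : Fin n × Fin n ≃ M.E :=
  (Equiv.ofInjective _ cellEdge_injective).trans
    (Equiv.setCongr (hE.trans edgeSet_completeBipartiteGraph).symm)

theorem val_image_cellEquiv {n : ℕ} {M : Matroid (Sym2 (Fin n ⊕ Fin n))}
    (hE : M.E = (completeBipartiteGraph (Fin n) (Fin n)).edgeSet) (C : Set (Fin n × Fin n)) :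
    Subtype.val '' (cellEquiv hE '' C) = cellEdge '' C := by
  rw [Set.image_image]
  rfl

/-! ### Independence as a count of ends -/

/-- A forest has $|V| - |C|$ components. The vertices that are not ends, together with one end, lie
in distinct components, so $|V| - |V(C)| + 1 \le |V| - |C|$. -/
theorem card_lt_edgeEnds_of_isAcyclic {V : Type*} [Finite V] {C : Set (Sym2 V)}
    (hd : ∀ e ∈ C, ¬ e.IsDiag) (hC : (fromEdgeSet C).IsAcyclic) (hne : C.Nonempty) :
    C.ncard < (edgeEnds C).ncard := by
  have hcard := card_forest C hd hC
  obtain ⟨e, he⟩ := hne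
  obtain ⟨u, hu⟩ : ∃ u, u ∈ e := by induction e using Sym2.ind with | _ a b; exact ⟨a, by simp⟩
  have hu : u ∈ edgeEnds C := ⟨e, he, hu⟩
  -- the vertices that are not ends of edges are components of their own
  have hiso : ∀ v w, v ∉ edgeEnds C → (fromEdgeSet C).Reachable v w → v = w := by
    rintro v w hv ⟨p⟩
    cases p with
    | nil => rfl
    | cons h p => exact absurd ⟨_, ((fromEdgeSet_adj C).1 h).1, Sym2.mem_mk_left _ _⟩ hv
  have hinj : Set.InjOn (fromEdgeSet C).connectedComponentMk (insert u (edgeEnds C)ᶜ) := by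
    rintro v hv w hw h
    rw [ConnectedComponent.eq] at h
    rcases hv with rfl | hv
    · rcases hw with rfl | hw
      · rfl
      · exact (hiso w v hw h.symm).symm
    · exact hiso v w hv h
  have h1 := hinj.ncard_image
  have h2 := Set.ncard_le_card
    ((fromEdgeSet C).connectedComponentMk '' (insert u (edgeEnds C)ᶜ))
  rw [h1, Set.ncard_insert_of_notMem (by simpa using hu)] at h2
  have h3 := Set.ncard_add_ncard_compl (edgeEnds C)
  omega

theorem edgeEnds_le_of_isCycleEdgeSet {V : Type*} [Finite V] {G : SimpleGraph V}
    {C : Set (Sym2 V)} (h : G.IsCycleEdgeSet C) : C.Nonempty ∧ (edgeEnds C).ncard ≤ C.ncard := by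
  obtain ⟨u, c, hc, rfl⟩ := h
  constructor
  · obtain ⟨e, he⟩ := List.exists_mem_of_ne_nil c.edges (by simpa using hc.not_nil)
    exact ⟨e, he⟩
  · rw [ncard_edgeSet_walk hc.isTrail]
    have hsub : edgeEnds c.edgeSet ⊆ {x | x ∈ c.support.tail} := by
      intro x hx
      rcases c.mem_support_iff.1 (mem_support_of_mem_edgeEnds hx) with rfl | h
      · exact Walk.end_mem_tail_support hc.not_nil
      · exact h
    have := (Set.ncard_le_ncard hsub (Set.toFinite _)).trans (ncard_list_le _)
    simpa using this

theorem cycleMatroid_ground {V : Type*} [Finite V] (G : SimpleGraph V) :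
    G.cycleMatroid.E = G.edgeSet := rfl

theorem bicircularMatroid_ground {V : Type*} [Finite V] (G : SimpleGraph V) :
    G.bicircularMatroid.E = G.edgeSet := rfl

theorem cycleMatroid_indep_iff {V : Type*} [Finite V] {G : SimpleGraph V} {I : Set (Sym2 V)}
    (hI : I ⊆ G.edgeSet) :
    G.cycleMatroid.Indep I ↔ ∀ C ⊆ I, C.Nonempty → C.ncard + 1 ≤ (edgeEnds C).ncard := by
  have : G.cycleMatroid.Indep I ↔ I ⊆ G.edgeSet ∧ ∀ C ⊆ I, ¬ G.IsCycleEdgeSet C := Iff.rfl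
  rw [this, and_iff_right hI]
  constructor
  · intro h C hC hne
    have hCG := hC.trans hI
    exact card_lt_edgeEnds_of_isAcyclic (fun e he => G.not_isDiag_of_mem_edgeSet (hCG he))
      ((cycleFree_iff_isAcyclic hCG).1 fun D hD => h D (hD.trans hC)) hne
  · intro h C hC hcyc
    obtain ⟨hne, hle⟩ := edgeEnds_le_of_isCycleEdgeSet hcyc
    have := h C hC hne
    omega

/-- This is `bicycleFree_iff` in the shape required for `c = 0`; the empty set meets the bound
trivially, so excluding it changes nothing. -/
theorem bicircularMatroid_indep_iff {V : Type*} [Finite V] {G : SimpleGraph V}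
    {I : Set (Sym2 V)} (hI : I ⊆ G.edgeSet) :
    G.bicircularMatroid.Indep I ↔ ∀ C ⊆ I, C.Nonempty → C.ncard + 0 ≤ (edgeEnds C).ncard := by
  have : G.bicircularMatroid.Indep I ↔ I ⊆ G.edgeSet ∧ ∀ C ⊆ I, ¬ G.IsBicycleEdgeSet C := Iff.rfl
  rw [this, and_iff_right hI, bicycleFree_iff hI]
  refine forall₂_congr fun C _ => ⟨fun h _ => h, fun h => ?_⟩
  rcases C.eq_empty_or_nonempty with rfl | hne
  · simp
  · exact h hne

theorem isCircuit_cycleMatroid_iff {n : ℕ} (C : Set (Fin n × Fin n)) :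
    (completeBipartiteGraph (Fin n) (Fin n)).cycleMatroid.IsCircuit
      (Subtype.val '' (cellEquiv (cycleMatroid_ground _) '' C)) ↔
      Minimal (Overfull 1) C := by
  rw [val_image_cellEquiv]
  exact isCircuit_iff_minimal_overfull (cycleMatroid_ground _)
    (fun _ hI => cycleMatroid_indep_iff hI) C

theorem isCircuit_bicircularMatroid_iff {n : ℕ} (C : Set (Fin n × Fin n)) :
    (completeBipartiteGraph (Fin n) (Fin n)).bicircularMatroid.IsCircuit
      (Subtype.val '' (cellEquiv (bicircularMatroid_ground _) '' C)) ↔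
      Minimal (Overfull 0) C := by
  rw [val_image_cellEquiv]
  exact isCircuit_iff_minimal_overfull (bicircularMatroid_ground _)
    (fun _ hI => bicircularMatroid_indep_iff hI) C

end SimpleGraph

theorem mainTheorem5 :
    (∀ n : ℕ, 2 < n →
      (completeBipartiteGraph (Fin n) (Fin n)).cycleMatroid.fixingNumber = (n : ℕ∞) ∧
      (completeBipartiteGraph (Fin n) (Fin n)).bicircularMatroid.fixingNumber = (n : ℕ∞)) ∧
    (completeBipartiteGraph (Fin 2) (Fin 2)).cycleMatroid.fixingNumber = 3 ∧
    (completeBipartiteGraph (Fin 2) (Fin 2)).bicircularMatroid.fixingNumber = 3 :=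
  ⟨fun _ hn =>
    ⟨Matroid.fixingNumber_eq_of_overfull hn le_rfl _ SimpleGraph.isCircuit_cycleMatroid_iff,
      Matroid.fixingNumber_eq_of_overfull hn zero_le_one _
        SimpleGraph.isCircuit_bicircularMatroid_iff⟩,
    Matroid.fixingNumber_eq_three_of_overfull le_rfl _ SimpleGraph.isCircuit_cycleMatroid_iff,
    Matroid.fixingNumber_eq_three_of_overfull zero_le_one _
      SimpleGraph.isCircuit_bicircularMatroid_iff⟩
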